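/- Conventions. Finite subsets of $\mathbb{N}$ are identified with the strictly increasing sequences of their elements. For $s\in[\mathbb{N}]^{<\omega}$ and $X\subseteq\mathbb{N}$, write $s\le_{in}X$ if $s$ is an initial segment of $X$. For $s,t\in[\mathbb{N}]^{<\omega}$, write $s\triangleleft t$ if there is $r\in[\mathbb{N}]^{<\omega}$ such that $s$ is a proper initial segment of $r$ and $t$ is obtained from $r$ by deleting its least element. A *barrier* is an infinite set $B\subseteq[\mathbb{N}]^{<\omega}$, no member of which is properly included in another, such that every infinite subset $X$ of $\bigcup B$ has a nonempty initial segment $s\le_{in}X$ with $s\in B$. Every barrier is well-ordered by the lexicographic order, and its *order type* is the order type for this order. For a countable ordinal $\alpha$, a poset $Q$ is *$\alpha$-better-quasi-ordered* ($\alpha$-bqo) if for every barrier $B$ of order type at most $\alpha$ and every map $f:B\to Q$ there are $s,t\in B$ with $s\triangleleft t$ and $f(s)\le f(t)$. For a poset $P$, let $AM_2(P)$ be the set of maximal antichains of $P$ having exactly two elements, ordered by domination: $X\le Y$ if for every $x\in X$ there is $y\in Y$ with $x\le y$. Let $\bigcup AM_2(P)\subseteq P$ be the union of these antichains, with the order induced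 by $P$. **Theorem.** Let $P$ be a poset with no infinite antichain and let $\alpha$ be a countable ordinal. Then $AM_2(P)$ is $\alpha$-bqo if and only if $\bigcup AM_2(P)$ is $\alpha$-bqo. -/

import Mathlib

namespace BQO

/-- `s` is an initial segment of `X`, where sets of natural numbers are identified with the
strictly increasing enumeration of their elements. -/
def IsInit (s : Finset ℕ) (X : Set ℕ) : Prop :=
  (s : Set ℕ) ⊆ X ∧ ∀ x ∈ X, ∀ y ∈ s, x ≤ y → x ∈ s

/-- The finite set obtained from `r` by deleting its least element (the tail of `∅` is `∅`). -/
def tail (r : Finset ℕ) : Finset ℕ :=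
  r.filter (fun x => ∃ y ∈ r, y < x)

/-- The relation `s ◁ t`: some `r` has `s` as a proper initial segment and `t` as its tail. -/
def Shift (s t : Finset ℕ) : Prop :=
  ∃ r : Finset ℕ, IsInit s (r : Set ℕ) ∧ s ≠ r ∧ t = tail r

/-- The strict lexicographic order on finite sets of natural numbers, each listed in increasing
order. -/
def LexLT (s t : Finset ℕ) : Prop :=
  s.sort (· ≤ ·) < t.sort (· ≤ ·)

/-- The union of the members of `B`. -/
def dom (B : Set (Finset ℕ)) : Set ℕ :=
  {n | ∃ s ∈ B, n ∈ s}

/-- A block: an infinite set `B` of finite sets of natural numbers such that every infinite subset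
of the union of `B` has a nonempty initial segment in `B`. -/
def IsBlock (B : Set (Finset ℕ)) : Prop :=
  B.Infinite ∧
    ∀ X : Set ℕ, X ⊆ dom B → X.Infinite → ∃ s ∈ B, s.Nonempty ∧ IsInit s X

/-- A barrier: a block that is an antichain under inclusion. -/
def IsBarrier (B : Set (Finset ℕ)) : Prop :=
  IsBlock B ∧ IsAntichain (· ⊆ ·) B

/-- The set `B` is well-ordered by the lexicographic order and its order type is at most `α`.
(Every barrier is well-ordered by the lexicographic order.) -/
def LexTypeLE (B : Set (Finset ℕ)) (α : Ordinal.{0}) : Prop :=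
  ∃ h : IsWellOrder B (fun s t => LexLT s.1 t.1),
    @Ordinal.type B (fun s t => LexLT s.1 t.1) h ≤ α

/-- A map from (a barrier) `B` into `Q` is good if `f s ≤ f t` for some `s ◁ t` in `B`. -/
def IsGood {Q : Type*} [Preorder Q] {B : Set (Finset ℕ)} (f : B → Q) : Prop :=
  ∃ s t : B, Shift s.1 t.1 ∧ f s ≤ f t

/-- `Q` is `α`-better-quasi-ordered: every map into `Q` from a barrier of order type at most `α`
is good. -/
def IsAlphaBqo (α : Ordinal.{0}) (Q : Type*) [Preorder Q] : Prop :=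
  ∀ B : Set (Finset ℕ), IsBarrier B → LexTypeLE B α → ∀ f : B → Q, IsGood f

/-- The type of the `n`-element maximal antichains of `P`. -/
@[ext] structure AM (n : ℕ) (P : Type*) [PartialOrder P] where
  carrier : Set P
  isMaxAntichain : IsMaxAntichain (· ≤ ·) carrier
  encard_eq : carrier.encard = n

/-- The domination order on the `n`-element maximal antichains: `X ≤ Y` if every element of `X`
is below some element of `Y`. -/
instance (n : ℕ) (P : Type*) [PartialOrder P] : PartialOrder (AM n P) where
  le X Y := ∀ x ∈ X.carrier, ∃ y ∈ Y.carrier, x ≤ y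
  le_refl X x hx := ⟨x, hx, le_rfl⟩
  le_trans X Y Z hXY hYZ x hx := by
    obtain ⟨y, hy, hxy⟩ := hXY x hx
    obtain ⟨z, hz, hyz⟩ := hYZ y hy
    exact ⟨z, hz, hxy.trans hyz⟩
  le_antisymm X Y hXY hYX := by
    have key : ∀ X Y : AM n P, (∀ x ∈ X.carrier, ∃ y ∈ Y.carrier, x ≤ y) →
        (∀ y ∈ Y.carrier, ∃ x ∈ X.carrier, y ≤ x) → X.carrier ⊆ Y.carrier := by
      intro X Y hXY hYX x hx
      obtain ⟨y, hy, hxy⟩ := hXY x hx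
      obtain ⟨x', hx', hyx'⟩ := hYX y hy
      have hxx' : x = x' := X.isMaxAntichain.1.eq hx hx' (hxy.trans hyx')
      have hyx : x = y := le_antisymm hxy (hxx' ▸ hyx')
      exact hyx ▸ hy
    exact AM.ext (Set.Subset.antisymm (key X Y hXY hYX) (key Y X hYX hXY))

/-- The union of all `n`-element maximal antichains of `P`; as a type it carries the order induced
by `P`. -/
def unionAM (n : ℕ) (P : Type*) [PartialOrder P] : Set P :=
  ⋃ X : AM n P, X.carrier

end BQO

/-! By Galvin's lemma, a map from a barrier to an α-bqo is increasing along shifts on the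
restriction to some infinite set, and restricting keeps the order type at most α. If the union is
α-bqo, list each antichain as a pair, make the first coordinates increasing, then use goodness of
the second coordinates.

For the converse, let `u` be bad and let `p` give the other point of an antichain through `u`. Make
the antichains increasing along shifts: badness and maximality then force `u s ≤ p (u t)` and `p (u
s) ≤ u t`. Read `u` and `p ∘ u` as locally constant functions `f`, `g` of an infinite set. Deleting
the least element swaps them, so inserting one extra point changes parity: both values at `W` lie
below both values at any set far enough out. Maximality and badness contradict this
(`alternation_false`). -/

namespace BQO

/-! ### Fusion and Galvin's lemma -/

/-- The fusion argument: a property of finite sets and infinite reservoirs that can always be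
extended by a point of the reservoir can be extended along an infinite set. -/
theorem exists_fusion {G : Finset ℕ → Set ℕ → Prop}
    (anti : ∀ S N N', N' ⊆ N → G S N → G S N')
    {M : Set ℕ} (hM : M.Infinite) (h0 : G ∅ M)
    (step : ∀ S N, N ⊆ M → N.Infinite → G S N →
      ∃ n ∈ N, ∃ N' ⊆ N, N'.Infinite ∧ G (insert n S) N') :
    ∃ N ⊆ M, N.Infinite ∧ ∀ n ∈ N, ∃ S : Finset ℕ, (∀ x, x ∈ S ↔ x ∈ N ∧ x ≤ n) ∧
      G S {m ∈ N | n < m} := by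
  classical
  let T := {p : Finset ℕ × Set ℕ // p.2 ⊆ M ∧ p.2.Infinite ∧ G p.1 p.2}
  have hstep : ∀ p : T, ∃ n, ∃ q : T, n ∈ p.1.2 ∧ q.1.1 = insert n p.1.1 ∧
      q.1.2 ⊆ p.1.2 ∧ ∀ m ∈ q.1.2, n < m := by
    rintro ⟨⟨S, N⟩, h1, h2, h3⟩
    obtain ⟨n, hn, N', hN', hinf, hG⟩ := step S N h1 h2 h3
    refine ⟨n, ⟨⟨insert n S, {m ∈ N' | n < m}⟩, ?_, ?_, ?_⟩, hn, rfl, ?_, ?_⟩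
    · exact fun m hm => h1 (hN' hm.1)
    · have : {m ∈ N' | n < m} = N' \ Set.Iic n := by
        ext m; simp
      simp only [this]
      exact hinf.sdiff (Set.finite_Iic n)
    · exact anti _ _ _ (fun m hm => hm.1) hG
    · exact fun m hm => hN' hm.1
    · exact fun m hm => hm.2
  choose nx q hmem hins hsub hlt using hstep
  let st : ℕ → T := fun k => Nat.rec ⟨(∅, M), subset_rfl, hM, h0⟩ (fun _ p => q p) k
  have st_succ : ∀ k, st (k + 1) = q (st k) := fun k => rfl
  let a : ℕ → ℕ := fun k => nx (st k)
  have mono : ∀ i j, i ≤ j → (st j).1.2 ⊆ (st i).1.2 := by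
    intro i j hij
    induction j, hij using Nat.le_induction with
    | base => exact subset_rfl
    | succ j _ ih => rw [st_succ]; exact (hsub _).trans ih
  have amem : ∀ k, a k ∈ (st k).1.2 := fun k => hmem _
  have alt : ∀ i j, i < j → a i < a j := fun i j hij =>
    hlt (st i) _ (mono (i + 1) j hij (amem j))
  have amono : StrictMono a := fun i j h => alt i j h
  have hS : ∀ k, ∀ x, x ∈ (st k).1.1 ↔ ∃ i < k, a i = x := by
    intro k
    induction k with
    | zero => intro x; simp [st]
    | succ k ih =>
      intro x
      rw [st_succ, hins, Finset.mem_insert, ih]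
      constructor
      · rintro (rfl | ⟨i, hi, rfl⟩)
        · exact ⟨k, k.lt_succ_self, rfl⟩
        · exact ⟨i, by omega, rfl⟩
      · rintro ⟨i, hi, rfl⟩
        rcases Nat.lt_succ_iff_lt_or_eq.1 hi with h | rfl
        · exact Or.inr ⟨i, h, rfl⟩
        · exact Or.inl rfl
  refine ⟨Set.range a, ?_, Set.infinite_range_of_injective amono.injective, ?_⟩
  · rintro _ ⟨k, rfl⟩
    exact (st k).2.1 (amem k)
  · rintro _ ⟨k, rfl⟩
    refine ⟨(st (k + 1)).1.1, fun x => (hS (k + 1) x).trans ?_, anti _ _ _ ?_ (st (k + 1)).2.2.2⟩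
    · constructor
      · rintro ⟨i, hi, rfl⟩
        exact ⟨⟨i, rfl⟩, amono.monotone (by omega)⟩
      · rintro ⟨⟨i, rfl⟩, hi⟩
        exact ⟨i, by have := amono.le_iff_le.1 hi; omega, rfl⟩
    · rintro _ ⟨⟨j, rfl⟩, hj⟩
      exact mono (k + 1) j (amono.lt_iff_lt.1 hj) (amem j)

/-- `N` accepts `s`: every infinite continuation of `s` inside `N` has an initial segment in
`F`. -/
def Accepts (F : Set (Finset ℕ)) (s : Finset ℕ) (N : Set ℕ) : Prop :=
  ∀ X ⊆ N, X.Infinite → (∀ x ∈ X, ∀ y ∈ s, y < x) → ∃ u ∈ F, IsInit u (↑s ∪ X)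

/-- `N` rejects `s`: no infinite subset of `N` accepts `s`. -/
def Rejects (F : Set (Finset ℕ)) (s : Finset ℕ) (N : Set ℕ) : Prop :=
  ∀ N' ⊆ N, N'.Infinite → ¬ Accepts F s N'

/-- Otherwise fusion gives an infinite `A` in which each `n` has some `t ⊆ S` with `insert n t`
accepted by the later points. A single `t` serves infinitely many `n`, and these `n` form a set
accepting `t`. -/
theorem Rejects.exists_insert {F : Set (Finset ℕ)} {S : Finset ℕ} {N : Set ℕ} (hN : N.Infinite)
    (h : ∀ t ⊆ S, Rejects F t N) :
    ∃ n ∈ N, ∃ N' ⊆ N, N'.Infinite ∧ ∀ t ⊆ insert n S, Rejects F t N' := by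
  classical
  by_contra hcon
  push Not at hcon
  have key : ∀ N' ⊆ N, N'.Infinite → ∃ n ∈ N', ∃ N'' ⊆ N', N''.Infinite ∧
      ∃ t ⊆ S, Accepts F (insert n t) N'' := by
    intro N' hN' hinf
    obtain ⟨n, hn⟩ := hinf.nonempty
    obtain ⟨t, ht, hrej⟩ := hcon n (hN' hn) N' hN' hinf
    simp only [Rejects, not_forall, not_not] at hrej
    obtain ⟨N'', hN'', hinf'', hacc⟩ := hrej
    have hnt : n ∈ t := by
      by_contra hnt
      exact h t ((Finset.subset_insert_iff_of_notMem hnt).1 ht) N'' (hN''.trans hN') hinf'' hacc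
    refine ⟨n, hn, N'', hN'', hinf'', t.erase n, ?_, ?_⟩
    · exact Finset.subset_insert_iff.1 ht
    · rwa [Finset.insert_erase hnt]
  obtain ⟨A, hA, hAinf, hAacc⟩ := exists_fusion
    (G := fun U N' => ∀ n ∈ U, ∃ t ⊆ S, Accepts F (insert n t) N')
    (fun U N' N'' hsub hG n hn => by
      obtain ⟨t, ht, hacc⟩ := hG n hn
      exact ⟨t, ht, fun X hX => hacc X (hX.trans hsub)⟩) hN (by simp)
    (fun U N' hN' hinf hG => by
      obtain ⟨n, hn, N'', hN'', hinf'', t, ht, hacc⟩ := key N' hN' hinf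
      refine ⟨n, hn, N'', hN'', hinf'', fun m hm => ?_⟩
      rcases Finset.mem_insert.1 hm with rfl | hm
      · exact ⟨t, ht, hacc⟩
      · obtain ⟨t', ht', hacc'⟩ := hG m hm
        exact ⟨t', ht', fun X hX => hacc' X (hX.trans hN'')⟩)
  have hA' : ∀ n ∈ A, ∃ t ⊆ S, Accepts F (insert n t) {m ∈ A | n < m} := by
    intro n hn
    obtain ⟨U, hU, hG⟩ := hAacc n hn
    exact hG n ((hU n).2 ⟨hn, le_rfl⟩)
  choose! τ hτS hτ using hA'
  obtain ⟨t, ht, hinf⟩ : ∃ t ∈ S.powerset, (A ∩ τ ⁻¹' {t}).Infinite := by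
    by_contra hfin
    push Not at hfin
    refine hAinf (Set.Finite.subset (S.powerset.finite_toSet.biUnion fun t ht => hfin t ht) ?_)
    intro n hn
    simp only [Set.mem_iUnion]
    exact ⟨τ n, by simpa using hτS n hn, hn, rfl⟩
  refine h t (Finset.mem_powerset.1 ht) _ (Set.inter_subset_left.trans hA) hinf ?_
  intro X hX hXinf hlt
  -- Split `X` into its least element, moved into the stem, and the rest.
  have hmin : sInf X ∈ X := Nat.sInf_mem hXinf.nonempty
  obtain ⟨u, hu, hinit⟩ := hτ _ (hX hmin).1 (X \ {sInf X})
    (fun x hx => ⟨(hX hx.1).1, lt_of_le_of_ne (Nat.sInf_le hx.1) (Ne.symm hx.2)⟩)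
    (hXinf.sdiff (Set.finite_singleton _)) (by
      intro x hx y hy
      have h2 : τ (sInf X) = t := (hX hmin).2
      rw [h2] at hy
      rcases Finset.mem_insert.1 hy with rfl | hy
      · exact lt_of_le_of_ne (Nat.sInf_le hx.1) (Ne.symm hx.2)
      · exact hlt x hx.1 y hy)
  refine ⟨u, hu, ?_⟩
  have h2 : τ (sInf X) = t := (hX hmin).2
  rw [h2] at hinit
  convert hinit using 1
  ext x
  by_cases hx : x = sInf X
  · simp [hx, hmin]
  · simp [hx]

/-- Galvin's lemma. -/
theorem exists_homogeneous (F : Set (Finset ℕ)) {M : Set ℕ} (hM : M.Infinite) :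
    ∃ N ⊆ M, N.Infinite ∧ ((∀ s ∈ F, ¬ (s : Set ℕ) ⊆ N) ∨
      ∀ X ⊆ N, X.Infinite → ∃ s ∈ F, IsInit s X) := by
  by_cases hrej : Rejects F ∅ M
  · obtain ⟨N, hN, hinf, hS⟩ := exists_fusion (G := fun S N => ∀ t ⊆ S, Rejects F t N)
      (fun S N N' hsub hG t ht N'' hN'' => hG t ht N'' (hN''.trans hsub)) hM
      (fun t ht => by rwa [Finset.subset_empty.1 ht])
      (fun S N _ hN hG => Rejects.exists_insert hN hG)
    refine ⟨N, hN, hinf, Or.inl fun s hs hsN => ?_⟩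
    obtain ⟨n, hn, hsn⟩ : ∃ n ∈ N, ∀ x ∈ s, x ≤ n := by
      obtain ⟨n, hn, hlt⟩ := hinf.exists_gt (s.sup id)
      exact ⟨n, hn, fun x hx => (Finset.le_sup (f := id) hx).trans hlt.le⟩
    obtain ⟨S, hS, hG⟩ := hS n hn
    have hinf' : {m ∈ N | n < m}.Infinite := by
      have : {m ∈ N | n < m} = N \ Set.Iic n := by
        ext m; simp
      rw [this]
      exact hinf.sdiff (Set.finite_Iic n)
    -- A member of `F` is accepted by every reservoir.
    refine hG s (fun x hx => (hS x).2 ⟨hsN hx, hsn x hx⟩) _ subset_rfl hinf' ?_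
    intro X _ _ hlt
    refine ⟨s, hs, Set.subset_union_left, ?_⟩
    rintro x (hx | hx) y hy hxy
    · exact hx
    · exact absurd (hlt x hx y hy) (by omega)
  · simp only [Rejects, not_forall, not_not] at hrej
    obtain ⟨N, hN, hinf, hacc⟩ := hrej
    refine ⟨N, hN, hinf, Or.inr fun X hX hXinf => ?_⟩
    simpa using hacc X hX hXinf (by simp)

/-! ### Barriers and their restrictions -/

theorem IsInit.subset_or_subset {s t : Finset ℕ} {X : Set ℕ} (hs : IsInit s X) (ht : IsInit t X) :
    s ⊆ t ∨ t ⊆ s := by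
  by_contra! h
  obtain ⟨a, ha, hat⟩ := Finset.not_subset.1 h.1
  obtain ⟨b, hb, hbs⟩ := Finset.not_subset.1 h.2
  rcases le_total a b with hab | hab
  · exact hat (ht.2 a (hs.1 ha) b hb hab)
  · exact hbs (hs.2 b (ht.1 hb) a ha hab)

theorem IsBarrier.eq_of_isInit {B : Set (Finset ℕ)} (hB : IsBarrier B) {s t : Finset ℕ}
    (hs : s ∈ B) (ht : t ∈ B) {X : Set ℕ} (hsX : IsInit s X) (htX : IsInit t X) : s = t := by
  rcases hsX.subset_or_subset htX with h | h
  · exact hB.2.eq hs ht h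
  · exact (hB.2.eq ht hs h).symm

theorem IsBarrier.nonempty_of_mem {B : Set (Finset ℕ)} (hB : IsBarrier B) {s : Finset ℕ}
    (hs : s ∈ B) : s.Nonempty := by
  rw [Finset.nonempty_iff_ne_empty]
  rintro rfl
  refine hB.1.1 ((Set.finite_singleton (∅ : Finset ℕ)).subset fun t ht => ?_)
  exact (hB.2.eq hs ht (Finset.empty_subset t)).symm

theorem dom_infinite {B : Set (Finset ℕ)} (hB : B.Infinite) : (dom B).Infinite := by
  intro h
  refine hB ((h.toFinset.powerset.finite_toSet).subset fun s hs => ?_)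
  simp only [Finset.coe_powerset, Set.mem_preimage, Set.mem_powerset_iff]
  intro n hn
  simpa using ⟨s, hs, hn⟩

/-- The members of `B` contained in `M`. -/
def restrict (B : Set (Finset ℕ)) (M : Set ℕ) : Set (Finset ℕ) :=
  {s ∈ B | (s : Set ℕ) ⊆ M}

theorem dom_restrict_subset (B : Set (Finset ℕ)) (M : Set ℕ) : dom (restrict B M) ⊆ M := by
  rintro n ⟨s, hs, hn⟩
  exact hs.2 hn

theorem IsBarrier.restrict {B : Set (Finset ℕ)} (hB : IsBarrier B) {M : Set ℕ}
    (hM : M ⊆ dom B) (hinf : M.Infinite) : IsBarrier (restrict B M) := by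
  have hex : ∀ X ⊆ M, X.Infinite → ∃ s ∈ BQO.restrict B M, s.Nonempty ∧ IsInit s X := by
    intro X hX hXinf
    obtain ⟨s, hs, hne, hinit⟩ := hB.1.2 X (hX.trans hM) hXinf
    exact ⟨s, ⟨hs, hinit.1.trans hX⟩, hne, hinit⟩
  refine ⟨⟨fun hfin => ?_, fun X hX => hex X (hX.trans (dom_restrict_subset B M))⟩,
    hB.2.subset fun s hs => hs.1⟩
  have hdom : (dom (BQO.restrict B M)).Finite := by
    refine (hfin.biUnion (t := fun s => (s : Set ℕ)) fun s _ => s.finite_toSet).subset ?_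
    rintro n ⟨s, hs, hn⟩
    simp only [Set.mem_iUnion]
    exact ⟨s, hs, hn⟩
  obtain ⟨s, hs, ⟨n, hn⟩, hinit⟩ := hex _ Set.sdiff_subset (hinf.sdiff hdom)
  exact (hinit.1 hn).2 ⟨s, hs, hn⟩

theorem LexTypeLE.mono {B C : Set (Finset ℕ)} {α : Ordinal.{0}} (hB : LexTypeLE B α)
    (hC : C ⊆ B) : LexTypeLE C α := by
  obtain ⟨h, hle⟩ := hB
  let e : (fun s t : C => LexLT s.1 t.1) ↪r (fun s t : B => LexLT s.1 t.1) :=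
    ⟨⟨Set.inclusion hC, Set.inclusion_injective hC⟩, Iff.rfl⟩
  have hwo : IsWellOrder C (fun s t => LexLT s.1 t.1) := e.isWellOrder
  exact ⟨hwo, (Ordinal.type_le_iff'.2 ⟨e⟩).trans hle⟩

theorem isInit_coe_trans {s r : Finset ℕ} {X : Set ℕ} (hs : IsInit s (r : Set ℕ))
    (hr : IsInit r X) : IsInit s X :=
  ⟨hs.1.trans hr.1, fun x hx y hy hxy => hs.2 x (hr.2 x hx y (hs.1 hy) hxy) y hy hxy⟩

theorem isInit_tail {r : Finset ℕ} {X : Set ℕ} (hr : IsInit r X) :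
    IsInit (tail r) {x ∈ X | ∃ y ∈ X, y < x} := by
  constructor
  · intro x hx
    obtain ⟨hxr, y, hy, hyx⟩ := Finset.mem_filter.1 hx
    exact ⟨hr.1 hxr, y, hr.1 hy, hyx⟩
  · rintro x ⟨hx, y, hy, hyx⟩ z hz hxz
    have hxr := hr.2 x hx z (Finset.mem_filter.1 hz).1 hxz
    exact Finset.mem_filter.2 ⟨hxr, y, hr.2 y hy x hxr hyx.le, hyx⟩

/-! ### Ramsey property of barriers -/

/-- A relation on a barrier is homogeneous for shifts on the restriction to an infinite set. -/
theorem IsBarrier.exists_homogeneous {B : Set (Finset ℕ)} (hB : IsBarrier B)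
    (R : Finset ℕ → Finset ℕ → Prop) :
    ∃ M ⊆ dom B, M.Infinite ∧
      ((∀ s ∈ BQO.restrict B M, ∀ t ∈ BQO.restrict B M, Shift s t → ¬ R s t) ∨
        ∀ s ∈ BQO.restrict B M, ∀ t ∈ BQO.restrict B M, Shift s t → R s t) := by
  -- A shift is coded by the single finite set `r` witnessing it.
  obtain ⟨M, hM, hinf, h⟩ := BQO.exists_homogeneous
    {r | ∃ s ∈ B, tail r ∈ B ∧ IsInit s (r : Set ℕ) ∧ s ≠ r ∧ R s (tail r)} (dom_infinite hB.1.1)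
  refine ⟨M, hM, hinf, ?_⟩
  have hsub : ∀ {s r : Finset ℕ}, s ∈ BQO.restrict B M → tail r ∈ BQO.restrict B M →
      IsInit s (r : Set ℕ) → (r : Set ℕ) ⊆ M := by
    intro s r hs ht hinit x hx
    by_cases hmin : ∃ y ∈ r, y < x
    · exact ht.2 (Finset.mem_coe.2 (Finset.mem_filter.2 ⟨hx, hmin⟩))
    · obtain ⟨y, hy⟩ := hB.nonempty_of_mem hs.1
      push Not at hmin
      exact hs.2 (hinit.2 x hx y hy (hmin y (hinit.1 hy)))
  refine h.imp ?_ ?_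
  · rintro h s hs t ht ⟨r, hinit, hne, rfl⟩ hR
    exact h r ⟨s, hs.1, ht.1, hinit, hne, hR⟩ (hsub hs ht hinit)
  · rintro h s hs t ht ⟨r, hinit, hne, rfl⟩
    have hrX : IsInit r (↑r ∪ {n ∈ M | ∀ x ∈ r, x < n}) := by
      refine ⟨Set.subset_union_left, ?_⟩
      rintro x (hx | hx) y hy hxy
      · exact hx
      · exact absurd (hx.2 y hy) (by omega)
    have hXinf : {n ∈ M | ∀ x ∈ r, x < n}.Infinite := by
      refine (hinf.sdiff (Set.finite_Iic (r.sup id))).mono fun n hn => ⟨hn.1, fun x hx => ?_⟩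
      exact (Finset.le_sup (f := id) hx).trans_lt (not_le.1 hn.2)
    -- `u` may differ from `r`, but both begin the same infinite set, so the antichain property of
    -- `B` recovers the same pair.
    obtain ⟨u, ⟨s', hs', ht', hinit', -, hR⟩, huX⟩ := h _
      (Set.union_subset (hsub hs ht hinit) fun n hn => hn.1) (hXinf.mono Set.subset_union_right)
    have hss : s' = s :=
      hB.eq_of_isInit hs' hs.1 (isInit_coe_trans hinit' huX) (isInit_coe_trans hinit hrX)
    have htt : tail u = tail r := hB.eq_of_isInit ht' ht.1 (isInit_tail huX) (isInit_tail hrX)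
    rwa [hss, htt] at hR

theorem IsAlphaBqo.exists_perfect {α : Ordinal.{0}} {Q : Type*} [Preorder Q]
    (hQ : IsAlphaBqo α Q) {B : Set (Finset ℕ)} (hB : IsBarrier B) (hα : LexTypeLE B α)
    (f : B → Q) :
    ∃ M ⊆ dom B, M.Infinite ∧ ∀ s t : B, s.1 ∈ restrict B M → t.1 ∈ restrict B M →
      Shift s.1 t.1 → f s ≤ f t := by
  obtain ⟨M, hM, hinf, h⟩ := hB.exists_homogeneous
    fun s t => ∃ (hs : s ∈ B) (ht : t ∈ B), f ⟨s, hs⟩ ≤ f ⟨t, ht⟩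
  refine ⟨M, hM, hinf, ?_⟩
  rcases h with h | h
  · obtain ⟨s, t, hst, hle⟩ := hQ _ (hB.restrict hM hinf) (hα.mono fun s hs => hs.1)
      fun s => f ⟨s.1, s.2.1⟩
    exact absurd ⟨s.2.1, t.2.1, hle⟩ (h s.1 s.2 t.1 t.2 hst)
  · intro s t hs ht hst
    obtain ⟨_, _, hle⟩ := h s.1 hs t.1 ht hst
    exact hle

/-- Initial segments of consecutive infinite sets shift. -/
theorem IsBarrier.shift_of_isInit {B : Set (Finset ℕ)} (hB : IsBarrier B) {s t : Finset ℕ}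
    (hs : s ∈ B) (ht : t ∈ B) {a : ℕ} {X : Set ℕ} (ha : ∀ x ∈ X, a < x)
    (hsX : IsInit s (insert a X)) (htX : IsInit t X) : Shift s t := by
  have hr : IsInit (insert a t) (insert a X) := by
    constructor
    · intro x hx
      rcases Finset.mem_insert.1 hx with rfl | hx
      · exact Set.mem_insert _ _
      · exact Or.inr (htX.1 hx)
    · rintro x (rfl | hx) y hy hxy
      · exact Finset.mem_insert_self _ _
      · rcases Finset.mem_insert.1 hy with rfl | hy
        · exact absurd (ha x hx) (by omega)
        · exact Finset.mem_insert_of_mem (htX.2 x hx y hy hxy)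
  have hat : a ∉ t := fun h => lt_irrefl a (ha a (htX.1 h))
  have hnot : ¬ insert a t ⊆ s := fun h => by
    have : t = s := hB.2.eq ht hs ((Finset.subset_insert a t).trans h)
    exact hat (this ▸ h (Finset.mem_insert_self a t))
  refine ⟨insert a t, ?_, ?_, ?_⟩
  · have hsub := (hsX.subset_or_subset hr).resolve_right hnot
    exact ⟨hsub, fun x hx y hy hxy => hsX.2 x (hr.1 hx) y hy hxy⟩
  · rintro rfl
    exact hnot subset_rfl
  · ext x
    simp only [tail, Finset.mem_filter, Finset.mem_insert]
    constructor
    · intro hx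
      exact ⟨Or.inr hx, a, Or.inl rfl, ha x (htX.1 hx)⟩
    · rintro ⟨rfl | hx, y, rfl | hy, hyx⟩
      · exact absurd hyx (lt_irrefl _)
      · exact absurd (ha y (htX.1 hy)) (by omega)
      · exact hx
      · exact hx

/-! ### Alternating functions on infinite sets -/

section Alternation

variable {P : Type*} [PartialOrder P] {M : Set ℕ} {f g : Set ℕ → P}

theorem alternation_le
    (hfg : ∀ a ∈ M, ∀ X ⊆ M, X.Infinite → (∀ x ∈ X, a < x) →
      f (insert a X) ≤ g X ∧ g (insert a X) ≤ f X)
    (t : Finset ℕ) (ht : (t : Set ℕ) ⊆ M) {X : Set ℕ} (hX : X ⊆ M) (hinf : X.Infinite)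
    (htX : ∀ y ∈ t, ∀ x ∈ X, y < x) :
    (Even t.card → f (t ∪ X) ≤ f X ∧ g (t ∪ X) ≤ g X) ∧
      (¬ Even t.card → f (t ∪ X) ≤ g X ∧ g (t ∪ X) ≤ f X) := by
  induction t using Finset.induction_on_min with
  | empty => simp
  | insert a t hat ih =>
    have hnot : a ∉ t := fun h => lt_irrefl a (hat a h)
    rw [Finset.coe_insert, Set.insert_subset_iff] at ht
    obtain ⟨ih1, ih2⟩ := ih ht.2 fun y hy => htX y (Finset.mem_insert_of_mem hy)
    have hstep := hfg a ht.1 (t ∪ X) (Set.union_subset ht.2 hX)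
      (hinf.mono Set.subset_union_right) (by
        rintro x (hx | hx)
        · exact hat x hx
        · exact htX a (Finset.mem_insert_self a t) x hx)
    rw [Finset.card_insert_of_notMem hnot, Finset.coe_insert, Set.insert_union, Nat.even_add_one]
    constructor
    · intro he
      exact ⟨hstep.1.trans (ih2 he).2, hstep.2.trans (ih2 he).1⟩
    · intro he
      rw [not_not] at he
      exact ⟨hstep.1.trans (ih1 he).2, hstep.2.trans (ih1 he).1⟩

theorem alternation_le_of_far (hM : M.Infinite)
    (hfg : ∀ a ∈ M, ∀ X ⊆ M, X.Infinite → (∀ x ∈ X, a < x) →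
      f (insert a X) ≤ g X ∧ g (insert a X) ≤ f X)
    (hloc : ∀ X ⊆ M, X.Infinite → ∃ n, ∀ Y ⊆ M, Y.Infinite →
      (∀ x ≤ n, x ∈ X ↔ x ∈ Y) → f Y = f X ∧ g Y = g X)
    {W : Set ℕ} (hW : W ⊆ M) (hWinf : W.Infinite) :
    ∃ n, ∀ X ⊆ M, X.Infinite → (∀ x ∈ X, n < x) →
      f W ≤ f X ∧ f W ≤ g X ∧ g W ≤ f X ∧ g W ≤ g X := by
  classical
  obtain ⟨n, hn⟩ := hloc W hW hWinf
  obtain ⟨a, haM, hna⟩ := hM.exists_gt n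
  refine ⟨a, fun X hX hinf haX => ?_⟩
  have hfin : (W ∩ Set.Iic n).Finite := (Set.finite_Iic n).inter_of_right W
  have hmem : ∀ x, x ∈ hfin.toFinset ↔ x ∈ W ∧ x ≤ n := fun x => by simp
  have htM : (hfin.toFinset : Set ℕ) ⊆ M := fun x hx => hW ((hmem x).1 hx).1
  have key : ∀ Y ⊆ M, Y.Infinite → (∀ y ∈ Y, n < y) →
      (f W ≤ f Y ∧ g W ≤ g Y ∧ Even hfin.toFinset.card) ∨
        (f W ≤ g Y ∧ g W ≤ f Y ∧ ¬ Even hfin.toFinset.card) := by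
    intro Y hY hYinf hnY
    obtain ⟨h1, h2⟩ := alternation_le hfg hfin.toFinset htM hY hYinf
      fun y hy x hx => ((hmem y).1 hy).2.trans_lt (hnY x hx)
    obtain ⟨hf, hg⟩ := hn (hfin.toFinset ∪ Y) (Set.union_subset htM hY)
      (hYinf.mono Set.subset_union_right) (by
        intro x hx
        constructor
        · exact fun h => Or.inl (Finset.mem_coe.2 ((hmem x).2 ⟨h, hx⟩))
        · rintro (h | h)
          · exact ((hmem x).1 h).1
          · exact absurd (hnY x h) (by omega))
    rw [hf, hg] at h1 h2
    by_cases he : Even hfin.toFinset.card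
    · exact Or.inl ⟨(h1 he).1, (h1 he).2, he⟩
    · exact Or.inr ⟨(h2 he).1, (h2 he).2, he⟩
  obtain ⟨hs1, hs2⟩ := hfg a haM X hX hinf haX
  have k1 := key X hX hinf fun x hx => hna.trans (haX x hx)
  -- The extra point `a` supplies the comparisons of the other parity.
  have k2 := key (insert a X) (Set.insert_subset haM hX) (hinf.mono (Set.subset_insert a X)) (by
    rintro x (rfl | hx)
    · exact hna
    · exact hna.trans (haX x hx))
  rcases k1 with ⟨h1, h2, he⟩ | ⟨h1, h2, he⟩
  · rcases k2 with ⟨h3, h4, -⟩ | ⟨-, -, he'⟩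
    · exact ⟨h1, h3.trans hs1, h4.trans hs2, h2⟩
    · exact absurd he he'
  · rcases k2 with ⟨-, -, he'⟩ | ⟨h3, h4, -⟩
    · exact absurd he' he
    · exact ⟨h3.trans hs2, h1, h2, h4.trans hs1⟩

/-- Locally constant functions on infinite sets that alternate along shifts and whose values form
maximal antichains cannot be bad. -/
theorem alternation_false (hM : M.Infinite)
    (hfg : ∀ a ∈ M, ∀ X ⊆ M, X.Infinite → (∀ x ∈ X, a < x) →
      f (insert a X) ≤ g X ∧ g (insert a X) ≤ f X)
    (hbad : ∀ a ∈ M, ∀ X ⊆ M, X.Infinite → (∀ x ∈ X, a < x) → ¬ f (insert a X) ≤ f X)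
    (hanti : ∀ X ⊆ M, X.Infinite → ¬ f X ≤ g X)
    (hmax : ∀ X ⊆ M, X.Infinite → ∀ p, (p ≤ f X ∨ p ≤ g X) ∨ (f X ≤ p ∨ g X ≤ p))
    (hloc : ∀ X ⊆ M, X.Infinite → ∃ n, ∀ Y ⊆ M, Y.Infinite →
      (∀ x ≤ n, x ∈ X ↔ x ∈ Y) → f Y = f X ∧ g Y = g X) : False := by
  classical
  have tail_inf : ∀ n, (M ∩ Set.Ioi n).Infinite := fun n => by
    have : M ∩ Set.Ioi n = M \ Set.Iic n := by
      ext m; simp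
    rw [this]
    exact hM.sdiff (Set.finite_Iic n)
  have far := fun W (hW : W ⊆ M) hWinf => alternation_le_of_far hM hfg hloc hW hWinf
  -- For `insert a t`, take a tail of `M` far beyond `W`. By induction and maximality `f (t ∪ X)` is
  -- above one of its values, hence above both values at `W`; so `f (insert a t ∪ X)` below one of
  -- these would contradict `hbad`.
  have key : ∀ t : Finset ℕ, (t : Set ℕ) ⊆ M → ∀ W ⊆ M, W.Infinite → ∃ n, ∀ X ⊆ M, X.Infinite →
      (∀ x ∈ X, n < x) → (∀ y ∈ t, ∀ x ∈ X, y < x) → ¬ (f (t ∪ X) ≤ f W ∨ f (t ∪ X) ≤ g W) := by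
    intro t
    induction t using Finset.induction_on_min with
    | empty =>
      intro _ W hW hWinf
      obtain ⟨n, hn⟩ := far W hW hWinf
      refine ⟨n, fun X hX hinf hnX _ hle => ?_⟩
      obtain ⟨-, h2, -, h4⟩ := hn X hX hinf hnX
      simp only [Finset.coe_empty, Set.empty_union] at hle
      exact hanti X hX hinf (hle.elim (fun h => h.trans h2) fun h => h.trans h4)
    | insert a t hat ih =>
      intro ht W hW hWinf
      rw [Finset.coe_insert, Set.insert_subset_iff] at ht
      obtain ⟨m, hm⟩ := far W hW hWinf
      obtain ⟨n, hn⟩ := ih ht.2 (M ∩ Set.Ioi m) Set.inter_subset_left (tail_inf m)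
      refine ⟨n, fun X hX hinf hnX htX hle => ?_⟩
      obtain ⟨h1, h2, h3, h4⟩ := hm (M ∩ Set.Ioi m) Set.inter_subset_left (tail_inf m)
        fun x hx => hx.2
      have hge := (hmax (M ∩ Set.Ioi m) Set.inter_subset_left (tail_inf m) (f (t ∪ X))).resolve_left
        (hn X hX hinf hnX fun y hy => htX y (Finset.mem_insert_of_mem hy))
      refine hbad a ht.1 (t ∪ X) (Set.union_subset ht.2 hX) (hinf.mono Set.subset_union_right) ?_ ?_
      · rintro x (hx | hx)
        · exact hat x hx
        · exact htX a (Finset.mem_insert_self a t) x hx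
      · rw [Finset.coe_insert, Set.insert_union] at hle
        rcases hle with hle | hle <;> rcases hge with hge | hge
        · exact hle.trans (h1.trans hge)
        · exact hle.trans (h2.trans hge)
        · exact hle.trans (h3.trans hge)
        · exact hle.trans (h4.trans hge)
  -- With `t` an initial segment of `M` deciding `f M`, `f (t ∪ X) = f M` lies below the values far
  -- out, against `key`.
  obtain ⟨n, hn⟩ := hloc M subset_rfl hM
  obtain ⟨m, hm⟩ := far M subset_rfl hM
  have hfin : (M ∩ Set.Iic n).Finite := (Set.finite_Iic n).inter_of_right M
  have hmem : ∀ x, x ∈ hfin.toFinset ↔ x ∈ M ∧ x ≤ n := fun x => by simp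
  have htM : (hfin.toFinset : Set ℕ) ⊆ M := fun x hx => ((hmem x).1 hx).1
  obtain ⟨k, hk⟩ := key hfin.toFinset htM (M ∩ Set.Ioi m) Set.inter_subset_left (tail_inf m)
  have hlt : ∀ x ∈ M ∩ Set.Ioi (max n k), n < x ∧ k < x := fun x hx => max_lt_iff.1 hx.2
  refine hk (M ∩ Set.Ioi (max n k)) Set.inter_subset_left (tail_inf _) (fun x hx => (hlt x hx).2)
    (fun y hy x hx => ((hmem y).1 hy).2.trans_lt (hlt x hx).1) (Or.inl ?_)
  rw [(hn (hfin.toFinset ∪ M ∩ Set.Ioi (max n k)) (Set.union_subset htM Set.inter_subset_left)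
    ((tail_inf _).mono Set.subset_union_right) ?_).1]
  · exact (hm (M ∩ Set.Ioi m) Set.inter_subset_left (tail_inf m) fun x hx => hx.2).1
  · intro x hx
    constructor
    · exact fun h => Or.inl (Finset.mem_coe.2 ((hmem x).2 ⟨h, hx⟩))
    · rintro (h | h)
      · exact ((hmem x).1 h).1
      · exact h.1

end Alternation

/-! ### The two implications -/

theorem AM.exists_eq_pair {P : Type*} [PartialOrder P] (X : AM 2 P) :
    ∃ x y, X.carrier = {x, y} := by
  obtain ⟨x, y, -, h⟩ := Set.encard_eq_two.1 (by simpa using X.encard_eq)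
  exact ⟨x, y, h⟩

theorem exists_partner {P : Type*} [PartialOrder P] (x : unionAM 2 P) :
    ∃ (X : AM 2 P) (y : P), X.carrier = {x.1, y} ∧ x.1 ≠ y := by
  obtain ⟨X, hX⟩ := Set.mem_iUnion.1 x.2
  obtain ⟨a, b, hne, h⟩ := Set.encard_eq_two.1 (by simpa using X.encard_eq)
  rw [h] at hX
  rcases hX with hX | hX
  · exact ⟨X, b, by rw [h, hX], by rwa [hX]⟩
  · rw [Set.mem_singleton_iff] at hX
    exact ⟨X, a, by rw [h, hX, Set.pair_comm], by rw [hX]; exact hne.symm⟩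

theorem isAlphaBqo_AM_two {P : Type*} [PartialOrder P] {α : Ordinal.{0}}
    (h : IsAlphaBqo α (unionAM 2 P)) : IsAlphaBqo α (AM 2 P) := by
  intro B hB hα F
  choose x y hxy using fun X : AM 2 P => X.exists_eq_pair
  have hx : ∀ X, x X ∈ unionAM 2 P := fun X => Set.mem_iUnion.2 ⟨X, by rw [hxy]; simp⟩
  have hy : ∀ X, y X ∈ unionAM 2 P := fun X => Set.mem_iUnion.2 ⟨X, by rw [hxy]; simp⟩
  obtain ⟨M, hM, hinf, hle⟩ := h.exists_perfect hB hα fun s => ⟨x (F s), hx _⟩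
  obtain ⟨s, t, hst, hle'⟩ := h _ (hB.restrict hM hinf) (hα.mono fun s hs => hs.1)
    fun s => ⟨y (F ⟨s.1, s.2.1⟩), hy _⟩
  refine ⟨⟨s.1, s.2.1⟩, ⟨t.1, t.2.1⟩, hst, ?_⟩
  have hle1 := hle ⟨s.1, s.2.1⟩ ⟨t.1, t.2.1⟩ s.2 t.2 hst
  intro p hp
  rw [hxy] at hp
  rcases hp with rfl | rfl
  · exact ⟨_, by rw [hxy]; exact Or.inl rfl, hle1⟩
  · exact ⟨_, by rw [hxy]; exact Or.inr rfl, hle'⟩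

theorem isAlphaBqo_unionAM_two {P : Type*} [PartialOrder P] {α : Ordinal.{0}}
    (h : IsAlphaBqo α (AM 2 P)) : IsAlphaBqo α (unionAM 2 P) := by
  intro B hB hα u
  by_contra hbad
  choose A p hA hne using fun x : unionAM 2 P => exists_partner x
  have anti : ∀ x : unionAM 2 P, ¬ x.1 ≤ p x := fun x => by
    have hanti := (A x).isMaxAntichain.1
    rw [hA] at hanti
    exact hanti (by simp) (by simp) (hne x)
  have hmax : ∀ (x : unionAM 2 P) (q : P), (q ≤ x.1 ∨ q ≤ p x) ∨ (x.1 ≤ q ∨ p x ≤ q) := by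
    intro x q
    by_contra! hq
    obtain ⟨⟨h1, h2⟩, h3, h4⟩ := hq
    have hins : IsAntichain (· ≤ ·) (insert q (A x).carrier) := by
      refine (A x).isMaxAntichain.1.insert ?_ ?_
      · intro b hb _
        rw [hA] at hb
        rcases hb with rfl | rfl
        exacts [h3, h4]
      · intro b hb _
        rw [hA] at hb
        rcases hb with rfl | rfl
        exacts [h1, h2]
    have heq := (A x).isMaxAntichain.2 hins (Set.subset_insert _ _)
    have hq : q ∈ (A x).carrier := heq ▸ Set.mem_insert _ _
    rw [hA] at hq
    rcases hq with rfl | rfl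
    exacts [h1 le_rfl, h2 le_rfl]
  obtain ⟨M, hM, hinf, hle⟩ := h.exists_perfect hB hα fun s => A (u s)
  have cross : ∀ s t : B, s.1 ∈ restrict B M → t.1 ∈ restrict B M → Shift s.1 t.1 →
      (u s).1 ≤ p (u t) ∧ p (u s) ≤ (u t).1 := by
    intro s t hs ht hst
    have hF := hle s t hs ht hst
    have hnle : ¬ (u s).1 ≤ (u t).1 := fun hle => hbad ⟨s, t, hst, hle⟩
    have h1 : (u s).1 ≤ p (u t) := by
      obtain ⟨y, hy, hxy⟩ := hF (u s).1 (by rw [hA]; exact Or.inl rfl)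
      rw [hA] at hy
      rcases hy with rfl | rfl
      exacts [absurd hxy hnle, hxy]
    refine ⟨h1, ?_⟩
    obtain ⟨y, hy, hxy⟩ := hF (p (u s)) (by rw [hA]; exact Or.inr rfl)
    rw [hA] at hy
    rcases hy with rfl | rfl
    · exact hxy
    -- Here both points at `s` lie below `p (u t)`; comparing `u t` with the antichain at `s` leaves
    -- only `p (u s) ≤ u t`.
    rcases hmax (u s) (u t).1 with (hc | hc) | (hc | hc)
    · exact absurd (hc.trans h1) (anti _)
    · exact absurd (hc.trans hxy) (anti _)
    · exact absurd hc hnle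
    · exact hc
  obtain ⟨s₀, hs₀⟩ := hB.1.1.nonempty
  have hex : ∀ X : Set ℕ, ∃ s : B, X ⊆ M → X.Infinite → IsInit s.1 X := by
    intro X
    by_cases hX : X ⊆ M ∧ X.Infinite
    · obtain ⟨s, hs, -, hinit⟩ := hB.1.2 X (hX.1.trans hM) hX.2
      exact ⟨⟨s, hs⟩, fun _ _ => hinit⟩
    · exact ⟨⟨s₀, hs₀⟩, fun h1 h2 => absurd ⟨h1, h2⟩ hX⟩
  -- `β X` is the initial segment of `X` in `B`; it makes `u` a function of infinite subsets of `M`.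
  choose β hβ using hex
  have hβM : ∀ X ⊆ M, X.Infinite → (β X).1 ∈ restrict B M := fun X hX hXinf =>
    ⟨(β X).2, (hβ X hX hXinf).1.trans hX⟩
  have hshift : ∀ a ∈ M, ∀ X ⊆ M, X.Infinite → (∀ x ∈ X, a < x) →
      Shift (β (insert a X)).1 (β X).1 := fun a ha X hX hXinf haX =>
    hB.shift_of_isInit (β _).2 (β _).2 haX
      (hβ _ (Set.insert_subset ha hX) (hXinf.mono (Set.subset_insert a X))) (hβ X hX hXinf)
  refine alternation_false (f := fun X => (u (β X)).1) (g := fun X => p (u (β X))) hinf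
    ?_ ?_ ?_ ?_ ?_
  · intro a ha X hX hXinf haX
    exact cross _ _ (hβM _ (Set.insert_subset ha hX) (hXinf.mono (Set.subset_insert a X)))
      (hβM X hX hXinf) (hshift a ha X hX hXinf haX)
  · intro a ha X hX hXinf haX hle
    exact hbad ⟨_, _, hshift a ha X hX hXinf haX, hle⟩
  · exact fun X _ _ => anti _
  · exact fun X _ _ => hmax _
  · intro X hX hXinf
    refine ⟨(β X).1.sup id, fun Y hY hYinf hXY => ?_⟩
    have hinit : IsInit (β X).1 Y := by
      have hX' := hβ X hX hXinf
      have hsup : ∀ y ∈ (β X).1, y ≤ (β X).1.sup id := fun y hy => Finset.le_sup (f := id) hy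
      exact ⟨fun x hx => (hXY x (hsup x hx)).1 (hX'.1 hx), fun x hx y hy hxy =>
        hX'.2 x ((hXY x (hxy.trans (hsup y hy))).2 hx) y hy hxy⟩
    have heq : β Y = β X :=
      Subtype.ext (hB.eq_of_isInit (β Y).2 (β X).2 (hβ Y hY hYinf) hinit)
    simp only [heq, and_self]

end BQO

theorem theorem6p3 {P : Type*} [PartialOrder P]
    (hP : ∀ A : Set P, IsAntichain (· ≤ ·) A → A.Finite)
    (α : Ordinal.{0}) (hα : α.card ≤ Cardinal.aleph0) :
    BQO.IsAlphaBqo α (BQO.AM 2 P) ↔ BQO.IsAlphaBqo α (BQO.unionAM 2 P) :=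
  ⟨BQO.isAlphaBqo_unionAM_two, BQO.isAlphaBqo_AM_two⟩
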